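/- An \emph{$f$-ring} is an associative ring $G$ (not assumed commutative or unital) that is a lattice-ordered group under addition, in which $a,b\ge 0$ implies $ab\ge 0$, and in which $a\wedge b=0$ and $c\ge 0$ imply $ca\wedge b=ac\wedge b=0$. It is \emph{archimedean} if $0\le na\le b$ for all $n\in\mathbb N$ implies $a=0$. An \emph{$f$-algebra} is a real vector lattice with a real-bilinear associative multiplication satisfying the same three order conditions. For an archimedean lattice-ordered abelian group $G$, let $G^d$ be its divisible hull, ordered by $a/s\le b/s\iff a\le b$, and let $\overline{G^d}$ be the Dedekind--MacNeille completion of $G^d$ (the Dedekind cuts of $G^d$ with both sides nonempty), with its canonical structure of a Dedekind complete real vector lattice extending the lattice-ordered group $G^d$. The \emph{vector lattice cover} $R[G]$ of $G$ is the $\ell$-subspace of $\overline{G^d}$ generated by $G$, i.e. the smallest real linear subspace of $\overline{G^d}$ that contains $G$ and is closed under $\vee$ and $\wedge$. \textbf{Theorem.} If $G$ is an archimedean $f$-ring, then its vector lattice cover $R[G]$ is an $f$-algebra; that is, there is a multiplication on the vector lattice $R[G]$ which extends the multiplication of $G$ and makes $R[G]$ an $f$-algebra. -/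

import Mathlib

open scoped Pointwise

/-! ### Lattice-ordered abelian groups and `f`-rings

A (commutative) lattice-ordered group is given by
`[AddCommGroup A] [Lattice A] [IsOrderedAddMonoid A]`. -/

/-- A lattice-ordered group is archimedean if `0 ≤ a` and `n • a ≤ b` for all `n` force `a = 0`.
(Mathlib's class `Archimedean` is a different, much stronger condition on groups that are not
totally ordered.) -/
class IsArchimedeanLGroup (A : Type*) [AddCommGroup A] [Lattice A] : Prop where
  eq_zero_of_nsmul_le : ∀ a b : A, 0 ≤ a → (∀ n : ℕ, n • a ≤ b) → a = 0

/-- An abelian group is divisible if every element is `n`-divisible for every `n > 0`. -/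
class IsDivisibleGroup (A : Type*) [AddCommGroup A] : Prop where
  exists_nsmul_eq : ∀ n : ℕ, 0 < n → ∀ a : A, ∃ b : A, n • b = a

/-- An `f`-ring: an associative ring (not assumed to be commutative or to have a unit) which is a
lattice-ordered group under addition, in which products of nonnegative elements are nonnegative,
and such that `a ⊓ b = 0` and `0 ≤ c` imply `c * a ⊓ b = 0` and `a * c ⊓ b = 0`. -/
class IsFRing (A : Type*) [NonUnitalRing A] [Lattice A] : Prop extends IsOrderedAddMonoid A where
  mul_nonneg' : ∀ a b : A, 0 ≤ a → 0 ≤ b → 0 ≤ a * b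
  mul_left_inf : ∀ a b c : A, a ⊓ b = 0 → 0 ≤ c → (c * a) ⊓ b = 0
  mul_right_inf : ∀ a b c : A, a ⊓ b = 0 → 0 ≤ c → (a * c) ⊓ b = 0

/-- A bilinear multiplication on a vector lattice `V` (that is, on a lattice-ordered real vector
space) which makes `V` an `f`-algebra: it is associative, products of nonnegative elements are
nonnegative, and `a ⊓ b = 0` and `0 ≤ c` imply `c * a ⊓ b = 0` and `a * c ⊓ b = 0`. -/
structure IsFAlgebraMul {V : Type*} [AddCommGroup V] [Lattice V] [IsOrderedAddMonoid V]
    [Module ℝ V] [IsOrderedModule ℝ V] (m : V →ₗ[ℝ] V →ₗ[ℝ] V) : Prop where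
  assoc : ∀ a b c : V, m (m a b) c = m a (m b c)
  nonneg : ∀ a b : V, 0 ≤ a → 0 ≤ b → 0 ≤ m a b
  left_inf : ∀ a b c : V, a ⊓ b = 0 → 0 ≤ c → m c a ⊓ b = 0
  right_inf : ∀ a b c : V, a ⊓ b = 0 → 0 ≤ c → m a c ⊓ b = 0

namespace LGroup

section Basic

variable {E : Type*} [AddCommGroup E] [Lattice E] [IsOrderedAddMonoid E]

theorem add_inf_eq_zero {x y b : E} (hx : x ⊓ b = 0) (hy : y ⊓ b = 0) : (x + y) ⊓ b = 0 := by
  have x0 : 0 ≤ x := hx ▸ inf_le_left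
  have b0 : 0 ≤ b := hx ▸ inf_le_right
  have y0 : 0 ≤ y := hy ▸ inf_le_left
  apply le_antisymm _ (le_inf (add_nonneg x0 y0) b0)
  have h1 : (x + y) ⊓ b - y ≤ x ⊓ b := by
    refine le_inf ?_ ?_
    · rw [sub_le_iff_le_add]; exact inf_le_left
    · exact (sub_le_self _ y0).trans inf_le_right
  rw [hx, sub_nonpos] at h1
  exact (le_inf h1 inf_le_right).trans hy.le

theorem nsmul_inf_eq_zero {a b : E} (h : a ⊓ b = 0) (n : ℕ) : (n • a) ⊓ b = 0 := by
  induction n with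
  | zero => rw [zero_smul]; exact inf_eq_left.2 (h ▸ inf_le_right)
  | succ n ih => rw [succ_nsmul]; exact add_inf_eq_zero ih h

theorem posPart_sub_of_inf_eq_zero {u v : E} (h : u ⊓ v = 0) : (u - v)⁺ = u := by
  have h1 := inf_add_sup u v
  rw [h, zero_add] at h1
  have h2 : (u - v) ⊔ 0 = (u ⊔ v) - v := by rw [sup_sub, sub_self]
  rw [posPart_def, h2, h1, add_sub_cancel_right]

theorem nsmul_posPart (n : ℕ) (a : E) : (n • a)⁺ = n • a⁺ := by
  have h : (n • a⁺) ⊓ (n • a⁻) = 0 := by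
    apply nsmul_inf_eq_zero
    rw [inf_comm]
    apply nsmul_inf_eq_zero
    rw [inf_comm]
    exact posPart_inf_negPart_eq_zero a
  have := posPart_sub_of_inf_eq_zero h
  rwa [← nsmul_sub, posPart_sub_negPart] at this

theorem nsmul_sup_eq (n : ℕ) (a b : E) : n • (a ⊔ b) = n • a ⊔ n • b := by
  rw [sup_eq_add_posPart_sub, sup_eq_add_posPart_sub (n • a), ← nsmul_sub, nsmul_posPart, nsmul_add]

theorem nsmul_nonneg_iff {n : ℕ} (hn : 0 < n) {a : E} : 0 ≤ n • a ↔ 0 ≤ a := by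
  refine ⟨fun h => ?_, fun h => nsmul_nonneg h n⟩
  have h1 : n • (-a)⁺ = 0 := by
    rw [← nsmul_posPart, posPart_eq_zero, smul_neg]
    simpa using h
  have h2 : (-a)⁺ ≤ n • (-a)⁺ := le_self_nsmul (posPart_nonneg _) hn.ne'
  have h3 := (le_posPart (-a)).trans (h2.trans h1.le)
  simpa using h3

theorem nsmul_le_iff {n : ℕ} (hn : 0 < n) {a b : E} : n • a ≤ n • b ↔ a ≤ b := by
  rw [← sub_nonneg, ← nsmul_sub, nsmul_nonneg_iff hn, sub_nonneg]

theorem nsmul_inj {n : ℕ} (hn : 0 < n) {a b : E} : n • a = n • b ↔ a = b := by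
  rw [le_antisymm_iff, nsmul_le_iff hn, nsmul_le_iff hn, ← le_antisymm_iff]

theorem torsionFree (E : Type*) [AddCommGroup E] [Lattice E] [IsOrderedAddMonoid E] :
    IsAddTorsionFree E :=
  ⟨fun _ hn _ _ h => (nsmul_inj (Nat.pos_of_ne_zero hn)).1 h⟩

theorem nonpos_of_nsmul_le [IsArchimedeanLGroup E] {a b : E} (h : ∀ n : ℕ, n • a ≤ b) : a ≤ 0 := by
  rw [← posPart_eq_zero]
  refine IsArchimedeanLGroup.eq_zero_of_nsmul_le _ b⁺ (posPart_nonneg _) fun n => ?_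
  rw [← nsmul_posPart]
  exact posPart_mono (h n)

theorem zsmul_le_nsmul_abs (m : ℤ) (K : ℕ) (hm : |m| ≤ K) (x : E) : |m • x| ≤ K • |x| := by
  have key : ∀ (k : ℕ) (y : E), k ≤ K → k • y ≤ K • |y| := fun k y hk =>
    (nsmul_le_nsmul_right (le_abs_self y) k).trans (nsmul_le_nsmul_left (abs_nonneg y) hk)
  obtain ⟨k, rfl | rfl⟩ := m.eq_nat_or_neg
  · have hk : k ≤ K := by simpa using hm
    rw [natCast_zsmul, abs_le']
    refine ⟨key k x hk, ?_⟩
    rw [← smul_neg]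
    exact abs_neg x ▸ key k (-x) hk
  · have hk : k ≤ K := by simpa using hm
    rw [neg_smul, natCast_zsmul, abs_neg, abs_le']
    refine ⟨key k x hk, ?_⟩
    rw [← smul_neg]
    exact abs_neg x ▸ key k (-x) hk

/-- A family of elements is bounded. -/
def Near {ι : Type*} (f : ι → E) : Prop := ∃ e : E, ∀ n, |f n| ≤ e

theorem Near.add {ι : Type*} {f g : ι → E} (hf : Near f) (hg : Near g) :
    Near fun n => f n + g n := by
  obtain ⟨d, hd⟩ := hf
  obtain ⟨e, he⟩ := hg
  exact ⟨d + e, fun n => (abs_add_le _ _).trans (add_le_add (hd n) (he n))⟩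

theorem Near.neg {ι E : Type*} [AddCommGroup E] [Lattice E] {f : ι → E} (hf : Near f) : Near fun n => -f n := by
  obtain ⟨d, hd⟩ := hf
  exact ⟨d, fun n => by rw [abs_neg]; exact hd n⟩

theorem Near.zsmul {ι : Type*} {k : ι → ℤ} {K : ℕ} (hk : ∀ n, |k n| ≤ K) (x : E) :
    Near fun n => k n • x := ⟨K • |x|, fun n => zsmul_le_nsmul_abs _ _ (hk n) x⟩

theorem Near.eq_zero [IsArchimedeanLGroup E] {z : E} (h : Near fun n : ℤ => n • z) : z = 0 := by
  obtain ⟨e, he⟩ := h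
  apply le_antisymm
  · refine nonpos_of_nsmul_le (b := e) fun n => ?_
    simpa using (le_abs_self _).trans (he n)
  · rw [← neg_nonpos]
    refine nonpos_of_nsmul_le (b := e) fun n => ?_
    have := (neg_le_abs _).trans (he n)
    simpa using this

/-- The element `y` plays the role of `r • x`: the differences `n y - ⌊n r⌋ x` are bounded. -/
def IsRealMul (r : ℝ) (x y : E) : Prop := Near fun n : ℤ => n • y - ⌊n * r⌋ • x

namespace IsRealMul

theorem unique [IsArchimedeanLGroup E] {r : ℝ} {x y z : E} (hy : IsRealMul r x y)
    (hz : IsRealMul r x z) : y = z := by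
  rw [← sub_eq_zero]
  apply Near.eq_zero
  convert hy.add hz.neg using 2 with n
  rw [smul_sub]; abel

theorem add_right {r : ℝ} {x x' y y' : E} (h : IsRealMul r x y) (h' : IsRealMul r x' y') :
    IsRealMul r (x + x') (y + y') := by
  unfold IsRealMul
  convert h.add h' using 2 with n
  rw [smul_add, smul_add]; abel

theorem neg_right {E : Type*} [AddCommGroup E] [Lattice E] {r : ℝ} {x y : E} (h : IsRealMul r x y) : IsRealMul r (-x) (-y) := by
  unfold IsRealMul
  convert h.neg using 2 with n
  rw [smul_neg, smul_neg]; abel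

theorem add_left {r s : ℝ} {x y z : E} (h : IsRealMul r x y) (h' : IsRealMul s x z) :
    IsRealMul (r + s) x (y + z) := by
  have hk : ∀ n : ℤ, |⌊n * r⌋ + ⌊n * s⌋ - ⌊n * (r + s)⌋| ≤ (2 : ℕ) := by
    intro n
    have h1 := Int.floor_le (n * r); have h2 := Int.lt_floor_add_one (n * r)
    have h3 := Int.floor_le (n * s); have h4 := Int.lt_floor_add_one (n * s)
    have h5 := Int.floor_le (n * (r + s)); have h6 := Int.lt_floor_add_one (n * (r + s))
    rw [abs_le]
    constructor
    · have : (-2 : ℝ) ≤ ⌊n * r⌋ + ⌊n * s⌋ - ⌊n * (r + s)⌋ := by linarith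
      exact_mod_cast this
    · have : ⌊n * r⌋ + ⌊n * s⌋ - ⌊n * (r + s)⌋ ≤ (2 : ℝ) := by linarith
      exact_mod_cast this
  unfold IsRealMul
  convert (h.add h').add (Near.zsmul hk x) using 2 with n
  rw [smul_add, sub_smul, add_smul]; abel

theorem mul {r s : ℝ} {x y z : E} (h : IsRealMul s x y) (h' : IsRealMul r y z) :
    IsRealMul (r * s) x z := by
  obtain ⟨K, hK⟩ := exists_nat_ge (|s| + 1)
  have hk : ∀ n : ℤ, |⌊⌊n * r⌋ * s⌋ - ⌊n * (r * s)⌋| ≤ (K : ℤ) := by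
    intro n
    have h1 := Int.floor_le (n * r); have h2 := Int.lt_floor_add_one (n * r)
    have h3 := Int.floor_le (⌊n * r⌋ * s); have h4 := Int.lt_floor_add_one (⌊n * r⌋ * s)
    have h5 := Int.floor_le (n * (r * s)); have h6 := Int.lt_floor_add_one (n * (r * s))
    have h7 : |(⌊n * r⌋ - n * r) * s| ≤ |s| := by
      rw [abs_mul]
      apply mul_le_of_le_one_left (abs_nonneg s)
      rw [abs_le]; constructor <;> linarith
    have h8 : (⌊n * r⌋ - n * r) * s = ⌊n * r⌋ * s - n * (r * s) := by ring
    rw [h8, abs_le] at h7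
    rw [abs_le]
    constructor
    · have : (-K : ℝ) ≤ ⌊⌊n * r⌋ * s⌋ - ⌊n * (r * s)⌋ := by linarith
      exact_mod_cast this
    · have : ⌊⌊n * r⌋ * s⌋ - ⌊n * (r * s)⌋ ≤ (K : ℝ) := by linarith
      exact_mod_cast this
  have h2 : Near fun n : ℤ => ⌊n * r⌋ • y - ⌊⌊n * r⌋ * s⌋ • x := by
    obtain ⟨e, he⟩ := h
    exact ⟨e, fun n => he _⟩
  unfold IsRealMul
  convert (h'.add h2).add (Near.zsmul hk x) using 2 with n
  rw [sub_smul]; abel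

theorem one (x : E) : IsRealMul 1 x x :=
  ⟨0, fun n => by simp⟩

theorem zero_left (x : E) : IsRealMul 0 x 0 :=
  ⟨0, fun n => by simp⟩

theorem zero_right (r : ℝ) : IsRealMul r (0 : E) 0 :=
  ⟨0, fun n => by simp⟩

end IsRealMul

end Basic

end LGroup

/-! ### The divisible hull of a lattice-ordered group -/

/-- The divisible hull `G^d` of `G`, with elements `g / s` for `g : G` and `s : ℕ+`.  The group is
Mathlib's `DivisibleHull G`; the name is new because Mathlib orders `DivisibleHull G` only for
totally ordered `G`. -/
def DivHull (G : Type*) [AddCommGroup G] : Type _ := DivisibleHull G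

namespace DivHull

variable {G : Type*} [AddCommGroup G]

noncomputable instance : AddCommGroup (DivHull G) := inferInstanceAs (AddCommGroup (DivisibleHull G))

/-- The fraction `a / s`. -/
def mk (a : G) (s : ℕ+) : DivHull G := DivisibleHull.mk a s

/-- Two elements have a common denominator. -/
theorem exists_mk (x y : DivHull G) : ∃ (s : ℕ+) (a b : G), x = mk a s ∧ y = mk b s := by
  induction x using DivisibleHull.ind with | mk a s
  induction y using DivisibleHull.ind with | mk b t
  refine ⟨s * t, t.val • a, s.val • b, ?_, ?_⟩
  · refine DivisibleHull.mk_eq_mk.2 ⟨1, ?_⟩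
    simp [smul_smul]
  · refine DivisibleHull.mk_eq_mk.2 ⟨1, ?_⟩
    simp [smul_smul, mul_comm]

theorem mk_add (a b : G) (s : ℕ+) : mk (a + b) s = mk a s + mk b s :=
  DivisibleHull.mk_add_mk_left.symm

theorem nsmul_mk (n : ℕ) (a : G) (s : ℕ+) : n • mk a s = mk (n • a) s :=
  DivisibleHull.nsmul_mk n a s

theorem neg_mk (a : G) (s : ℕ+) : -mk a s = mk (-a) s := DivisibleHull.neg_mk a s

theorem mk_zero (s : ℕ+) : mk (0 : G) s = 0 := DivisibleHull.mk_zero s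

theorem mk_mul (a : G) (s t : ℕ+) : mk (t.val • a) (s * t) = mk a s := by
  refine DivisibleHull.mk_eq_mk.2 ⟨1, ?_⟩
  simp [smul_smul]

instance : IsDivisibleGroup (DivHull G) where
  exists_nsmul_eq n hn x := by
    obtain ⟨s, a, -, rfl, -⟩ := exists_mk x x
    refine ⟨mk a (s * ⟨n, hn⟩), ?_⟩
    rw [nsmul_mk]
    exact mk_mul a s ⟨n, hn⟩

variable [Lattice G] [IsOrderedAddMonoid G]

theorem mk_eq_mk {a b : G} {s t : ℕ+} : mk a s = mk b t ↔ t.val • a = s.val • b :=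
  haveI := LGroup.torsionFree G
  DivisibleHull.mk_eq_mk_iff_smul_eq_smul

/-- `a / s ≤ b / s` iff `a ≤ b`. -/
instance : LE (DivHull G) := ⟨fun x y => ∃ (s : ℕ+) (a b : G), x = mk a s ∧ y = mk b s ∧ a ≤ b⟩

theorem mk_le_mk {a b : G} {s : ℕ+} : mk a s ≤ mk b s ↔ a ≤ b := by
  refine ⟨?_, fun h => ⟨s, a, b, rfl, rfl, h⟩⟩
  rintro ⟨t, a', b', ha, hb, h⟩
  rw [mk_eq_mk] at ha hb
  rw [← LGroup.nsmul_le_iff t.pos, ha, hb]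
  exact nsmul_le_nsmul_right h _

instance : PartialOrder (DivHull G) where
  le_refl x := by
    obtain ⟨s, a, -, rfl, -⟩ := exists_mk x x
    exact mk_le_mk.2 le_rfl
  le_trans x y z hxy hyz := by
    obtain ⟨s, a, b, rfl, rfl⟩ := exists_mk x y
    obtain ⟨t, c, -, rfl, -⟩ := exists_mk z z
    rw [← mk_mul a s t, ← mk_mul b s t, mk_le_mk] at hxy
    rw [← mk_mul b s t, ← mk_mul c t s, mul_comm t s, mk_le_mk] at hyz
    rw [← mk_mul a s t, ← mk_mul c t s, mul_comm t s, mk_le_mk]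
    exact hxy.trans hyz
  le_antisymm x y hxy hyx := by
    obtain ⟨s, a, b, rfl, rfl⟩ := exists_mk x y
    rw [mk_le_mk] at hxy hyx
    rw [le_antisymm hxy hyx]

instance : IsOrderedAddMonoid (DivHull G) where
  add_le_add_left x y hxy z := by
    obtain ⟨s, a, b, rfl, rfl⟩ := exists_mk x y
    obtain ⟨t, c, -, rfl, -⟩ := exists_mk z z
    rw [mk_le_mk] at hxy
    rw [← mk_mul a s t, ← mk_mul b s t, ← mk_mul c t s, mul_comm t s, ← mk_add, ← mk_add, mk_le_mk]
    gcongr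

theorem isLUB_mk (a b : G) (s : ℕ+) : IsLUB {mk a s, mk b s} (mk (a ⊔ b) s) := by
  constructor
  · rintro _ (rfl | rfl)
    · exact mk_le_mk.2 le_sup_left
    · exact mk_le_mk.2 le_sup_right
  · intro u hu
    have h1 := hu (Set.mem_insert _ _)
    have h2 := hu (Set.mem_insert_of_mem _ (Set.mem_singleton _))
    obtain ⟨t, c, -, rfl, -⟩ := exists_mk u u
    rw [← mk_mul c t s, mul_comm t s] at h1 h2 ⊢
    rw [← mk_mul _ s t, mk_le_mk] at h1 h2 ⊢
    rw [LGroup.nsmul_sup_eq]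
    exact sup_le h1 h2

theorem isGLB_mk (a b : G) (s : ℕ+) : IsGLB {mk a s, mk b s} (mk (a ⊓ b) s) := by
  constructor
  · rintro _ (rfl | rfl)
    · exact mk_le_mk.2 inf_le_left
    · exact mk_le_mk.2 inf_le_right
  · intro u hu
    have h1 := hu (Set.mem_insert _ _)
    have h2 := hu (Set.mem_insert_of_mem _ (Set.mem_singleton _))
    have h3 := (isLUB_mk (-a) (-b) s).2 (show -u ∈ upperBounds _ by
      rintro _ (rfl | rfl)
      · rw [← neg_mk]; exact neg_le_neg h1
      · rw [← neg_mk]; exact neg_le_neg h2)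
    rw [← neg_inf, ← neg_mk] at h3
    exact neg_le_neg_iff.1 h3

theorem exists_isLUB (x y : DivHull G) : ∃ z, IsLUB {x, y} z := by
  obtain ⟨s, a, b, rfl, rfl⟩ := exists_mk x y
  exact ⟨_, isLUB_mk a b s⟩

theorem exists_isGLB (x y : DivHull G) : ∃ z, IsGLB {x, y} z := by
  obtain ⟨s, a, b, rfl, rfl⟩ := exists_mk x y
  exact ⟨_, isGLB_mk a b s⟩

/-- The partial order of the divisible hull is a lattice order, with
`a / s ⊔ b / s = (a ⊔ b) / s` and `a / s ⊓ b / s = (a ⊓ b) / s`. -/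
noncomputable instance : Lattice (DivHull G) :=
  Lattice.ofIsLUBofIsGLB (fun x y => (exists_isLUB x y).choose)
    (fun x y => (exists_isGLB x y).choose) (fun x y => (exists_isLUB x y).choose_spec)
    (fun x y => (exists_isGLB x y).choose_spec)

theorem mk_sup (a b : G) (s : ℕ+) : mk (a ⊔ b) s = mk a s ⊔ mk b s :=
  (isLUB_mk a b s).unique isLUB_pair

theorem mk_inf (a b : G) (s : ℕ+) : mk (a ⊓ b) s = mk a s ⊓ mk b s :=
  (isGLB_mk a b s).unique isGLB_pair

instance [IsArchimedeanLGroup G] : IsArchimedeanLGroup (DivHull G) where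
  eq_zero_of_nsmul_le x y hx h := by
    obtain ⟨s, a, b, rfl, rfl⟩ := exists_mk x y
    rw [← mk_zero s] at hx ⊢
    rw [mk_le_mk] at hx
    rw [IsArchimedeanLGroup.eq_zero_of_nsmul_le a b hx fun n => ?_]
    have := h n
    rwa [nsmul_mk, mk_le_mk] at this

end DivHull

/-! ### The Dedekind-MacNeille completion of an archimedean lattice-ordered group -/

/-- The Dedekind-MacNeille completion of a lattice-ordered group `D`: the Dedekind cuts of `D` with
both sides nonempty.  (As usual for ordered groups, the cuts `±∞` are left out: the result is
the smallest conditionally complete lattice that contains `D`.) -/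
def GroupCompletion (D : Type*) [Lattice D] : Type _ :=
  {A : DedekindCut D // A.left.Nonempty ∧ A.right.Nonempty}

namespace GroupCompletion

section Lattice

variable {D : Type*} [Lattice D]

/-- The underlying Dedekind cut. -/
def toCut (A : GroupCompletion D) : DedekindCut D := A.1

/-- The lower side of a cut. -/
def left (A : GroupCompletion D) : Set D := A.1.left

/-- The upper side of a cut. -/
def right (A : GroupCompletion D) : Set D := A.1.right

theorem left_nonempty (A : GroupCompletion D) : A.left.Nonempty := A.2.1

theorem right_nonempty (A : GroupCompletion D) : A.right.Nonempty := A.2.2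

theorem mem_right_iff {A : GroupCompletion D} {u : D} : u ∈ A.right ↔ ∀ a ∈ A.left, a ≤ u := by
  show u ∈ A.1.right ↔ _
  rw [← A.1.upperBounds_left]
  exact Iff.rfl

theorem mem_left_iff {A : GroupCompletion D} {u : D} : u ∈ A.left ↔ ∀ a ∈ A.right, u ≤ a := by
  show u ∈ A.1.left ↔ _
  rw [← A.1.lowerBounds_right]
  exact Iff.rfl

theorem ext_right {A B : GroupCompletion D} (h : ∀ u, u ∈ A.right ↔ u ∈ B.right) : A = B :=
  Subtype.ext (DedekindCut.ext' (Set.ext h))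

theorem sup_prop {x y : DedekindCut D} (hx : x.left.Nonempty ∧ x.right.Nonempty)
    (hy : y.left.Nonempty ∧ y.right.Nonempty) :
    (x ⊔ y).left.Nonempty ∧ (x ⊔ y).right.Nonempty := by
  obtain ⟨a, ha⟩ := hx.1
  obtain ⟨b, hb⟩ := hx.2
  obtain ⟨c, hc⟩ := hy.2
  refine ⟨⟨a, DedekindCut.principal_le_iff.1
      ((DedekindCut.principal_le_iff.2 ha).trans le_sup_left)⟩,
    ⟨b ⊔ c, DedekindCut.le_principal_iff.1 (sup_le ?_ ?_)⟩⟩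
  · exact (DedekindCut.le_principal_iff.2 hb).trans (DedekindCut.principal_le_principal.2 le_sup_left)
  · exact (DedekindCut.le_principal_iff.2 hc).trans (DedekindCut.principal_le_principal.2 le_sup_right)

theorem inf_prop {x y : DedekindCut D} (hx : x.left.Nonempty ∧ x.right.Nonempty)
    (hy : y.left.Nonempty ∧ y.right.Nonempty) :
    (x ⊓ y).left.Nonempty ∧ (x ⊓ y).right.Nonempty := by
  obtain ⟨a, ha⟩ := hx.2
  obtain ⟨b, hb⟩ := hx.1
  obtain ⟨c, hc⟩ := hy.1
  refine ⟨⟨b ⊓ c, DedekindCut.principal_le_iff.1 (le_inf ?_ ?_)⟩,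
    ⟨a, DedekindCut.le_principal_iff.1
      (inf_le_left.trans (DedekindCut.le_principal_iff.2 ha))⟩⟩
  · exact (DedekindCut.principal_le_principal.2 inf_le_left).trans (DedekindCut.principal_le_iff.2 hb)
  · exact (DedekindCut.principal_le_principal.2 inf_le_right).trans (DedekindCut.principal_le_iff.2 hc)

/-- Cuts are ordered by inclusion of their lower sides, as in Mathlib's `DedekindCut D`. -/
instance : Lattice (GroupCompletion D) :=
  Subtype.lattice (fun _ _ => sup_prop) (fun _ _ => inf_prop)

theorem le_iff {A B : GroupCompletion D} : A ≤ B ↔ ∀ u ∈ B.right, u ∈ A.right :=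
  Concept.intent_subset_intent_iff.symm

/-- The embedding of `D` in its completion. -/
def principal (d : D) : GroupCompletion D :=
  ⟨DedekindCut.principal d, ⟨d, le_refl d⟩, ⟨d, le_refl d⟩⟩

theorem mem_right_principal {d u : D} : u ∈ (principal d).right ↔ d ≤ u := Iff.rfl

theorem mem_left_principal {d u : D} : u ∈ (principal d).left ↔ u ≤ d := Iff.rfl

theorem principal_le_principal {c d : D} : principal c ≤ principal d ↔ c ≤ d :=
  DedekindCut.principal_le_principal

theorem principal_sup (c d : D) : principal (c ⊔ d) = principal c ⊔ principal d := by
  apply le_antisymm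
  · rw [le_iff]
    intro u hu
    have h1 := le_iff.1 (le_sup_left (a := principal c) (b := principal d)) u hu
    have h2 := le_iff.1 (le_sup_right (a := principal c) (b := principal d)) u hu
    exact sup_le h1 h2
  · exact sup_le (principal_le_principal.2 le_sup_left) (principal_le_principal.2 le_sup_right)

theorem principal_inf (c d : D) : principal (c ⊓ d) = principal c ⊓ principal d := by
  apply le_antisymm
  · exact le_inf (principal_le_principal.2 inf_le_left) (principal_le_principal.2 inf_le_right)
  · intro u hu
    have h1 : u ∈ (principal c).left := hu.1
    have h2 : u ∈ (principal d).left := hu.2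
    exact le_inf (mem_left_principal.1 h1) (mem_left_principal.1 h2)

theorem sSup_prop {S : Set (GroupCompletion D)} (h : S.Nonempty ∧ BddAbove S) :
    (sSup (toCut '' S)).left.Nonempty ∧ (sSup (toCut '' S)).right.Nonempty := by
  obtain ⟨⟨A, hA⟩, ⟨B, hB⟩⟩ := h
  obtain ⟨a, ha⟩ := A.2.1
  obtain ⟨b, hb⟩ := B.2.2
  refine ⟨⟨a, DedekindCut.principal_le_iff.1 ?_⟩, ⟨b, DedekindCut.le_principal_iff.1 ?_⟩⟩
  · exact (DedekindCut.principal_le_iff.2 ha).trans (le_sSup ⟨A, hA, rfl⟩)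
  · apply sSup_le
    rintro _ ⟨C, hC, rfl⟩
    exact (show C.1 ≤ B.1 from hB hC).trans (DedekindCut.le_principal_iff.2 hb)

end Lattice

section Group

variable {D : Type*} [Lattice D] [AddCommGroup D]

open Classical in
/-- The supremum of a nonempty set of cuts that is bounded above (and `0` for other sets). -/
noncomputable instance : SupSet (GroupCompletion D) :=
  ⟨fun S => if h : S.Nonempty ∧ BddAbove S then ⟨sSup (toCut '' S), sSup_prop h⟩
    else principal 0⟩

theorem isLUB_sSup {S : Set (GroupCompletion D)} (h : S.Nonempty) (h' : BddAbove S) :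
    IsLUB S (sSup S) := by
  have e : (sSup S).toCut = sSup (toCut '' S) := by
    exact congrArg toCut (dif_pos (show S.Nonempty ∧ BddAbove S from ⟨h, h'⟩))
  constructor
  · intro A hA
    show A.toCut ≤ (sSup S).toCut
    rw [e]
    exact le_sSup ⟨A, hA, rfl⟩
  · intro B hB
    show (sSup S).toCut ≤ B.toCut
    rw [e]
    apply sSup_le
    rintro _ ⟨C, hC, rfl⟩
    exact hB hC

instance : Zero (GroupCompletion D) := ⟨principal 0⟩

variable [IsOrderedAddMonoid D]

/-- `A + B` is the cut generated by the sums `a + b` with `a` and `b` in the lower sides of `A` and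
`B`; in other words, the supremum of these sums. -/
instance : Add (GroupCompletion D) :=
  ⟨fun A B => ⟨Concept.ofObjects (· ≤ ·) (A.left + B.left), by
    obtain ⟨a, ha⟩ := A.left_nonempty
    obtain ⟨b, hb⟩ := B.left_nonempty
    obtain ⟨u, hu⟩ := A.right_nonempty
    obtain ⟨v, hv⟩ := B.right_nonempty
    refine ⟨⟨a + b, subset_lowerPolar_upperPolar _ _ (Set.add_mem_add ha hb)⟩, ⟨u + v, ?_⟩⟩
    rintro _ ⟨a', ha', b', hb', rfl⟩
    exact add_le_add (mem_right_iff.1 hu a' ha') (mem_right_iff.1 hv b' hb')⟩⟩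

/-- `-A` is the cut whose lower side is the negative of the upper side of `A`. -/
instance : Neg (GroupCompletion D) :=
  ⟨fun A => ⟨⟨-A.right, -A.left, by
      ext u
      rw [Set.mem_neg, mem_left_iff, mem_upperPolar_iff]
      constructor
      · intro h a ha
        have : -a ≤ u := h (a := -a) (by simpa using ha)
        simpa using neg_le_neg this
      · intro h a ha
        exact neg_le_neg_iff.1 (h _ ha), by
      ext u
      rw [Set.mem_neg, mem_right_iff, mem_lowerPolar_iff]
      constructor
      · intro h a ha
        have : u ≤ -a := h (b := -a) (by simpa using ha)
        simpa using neg_le_neg this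
      · intro h a ha
        exact neg_le_neg_iff.1 (h _ ha)⟩,
    by
      obtain ⟨a, ha⟩ := A.left_nonempty
      obtain ⟨b, hb⟩ := A.right_nonempty
      exact ⟨⟨-b, Set.neg_mem_neg.2 hb⟩, ⟨-a, Set.neg_mem_neg.2 ha⟩⟩⟩⟩

theorem mem_right_add {A B : GroupCompletion D} {u : D} :
    u ∈ (A + B).right ↔ ∀ a ∈ A.left, ∀ b ∈ B.left, a + b ≤ u := by
  constructor
  · intro h a ha b hb
    exact h (Set.add_mem_add ha hb)
  · rintro h _ ⟨a, ha, b, hb, rfl⟩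
    exact h a ha b hb

theorem add_mem_left {A B : GroupCompletion D} {a b : D} (ha : a ∈ A.left) (hb : b ∈ B.left) :
    a + b ∈ (A + B).left :=
  mem_left_iff.2 fun _ hu => mem_right_add.1 hu a ha b hb

theorem mem_left_neg {A : GroupCompletion D} {u : D} : u ∈ (-A).left ↔ -u ∈ A.right := Iff.rfl

protected theorem add_comm (A B : GroupCompletion D) : A + B = B + A := by
  apply ext_right
  intro u
  rw [mem_right_add, mem_right_add]
  exact ⟨fun h b hb a ha => add_comm a b ▸ h a ha b hb,
    fun h b hb a ha => add_comm a b ▸ h a ha b hb⟩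

protected theorem add_assoc (A B C : GroupCompletion D) : A + B + C = A + (B + C) := by
  have key : ∀ (A B C : GroupCompletion D) (u : D), u ∈ (A + B + C).right ↔
      ∀ a ∈ A.left, ∀ b ∈ B.left, ∀ c ∈ C.left, a + b + c ≤ u := by
    intro A B C u
    rw [mem_right_add]
    constructor
    · intro h a ha b hb c hc
      exact h _ (add_mem_left ha hb) c hc
    · intro h x hx c hc
      rw [← le_sub_iff_add_le]
      refine mem_left_iff.1 hx _ (mem_right_add.2 fun a ha b hb => ?_)
      rw [le_sub_iff_add_le]
      exact h a ha b hb c hc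
  apply ext_right
  intro u
  rw [GroupCompletion.add_comm A (B + C), key, key]
  constructor
  · intro h b hb c hc a ha
    rw [add_comm, ← add_assoc]; exact h a ha b hb c hc
  · intro h a ha b hb c hc
    rw [add_assoc, add_comm]; exact h b hb c hc a ha

protected theorem zero_add (A : GroupCompletion D) : 0 + A = A := by
  apply ext_right
  intro u
  rw [mem_right_add, mem_right_iff]
  constructor
  · intro h a ha
    simpa using h 0 (mem_left_principal.2 le_rfl) a ha
  · intro h z hz a ha
    have hz : z ≤ 0 := hz
    exact (add_le_of_nonpos_left hz).trans (h a ha)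

theorem principal_add (c d : D) : principal (c + d) = principal c + principal d := by
  apply ext_right
  intro u
  rw [mem_right_add]
  constructor
  · intro h a ha b hb
    exact (add_le_add (show a ≤ c from ha) (show b ≤ d from hb)).trans h
  · intro h
    exact h c (mem_left_principal.2 le_rfl) d (mem_left_principal.2 le_rfl)

variable [IsArchimedeanLGroup D]

protected theorem neg_add_cancel (A : GroupCompletion D) : -A + A = 0 := by
  apply ext_right
  intro u
  rw [mem_right_add]
  constructor
  · intro h
    have step : ∀ a ∈ A.left, a - u ∈ A.left := by
      intro a ha
      refine mem_left_iff.2 fun b hb => ?_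
      have := h (-b) (by rw [mem_left_neg, neg_neg]; exact hb) a ha
      rw [neg_add_le_iff_le_add] at this
      rwa [sub_le_iff_le_add]
    obtain ⟨a, ha⟩ := A.left_nonempty
    obtain ⟨b, hb⟩ := A.right_nonempty
    have hn : ∀ n : ℕ, a + n • (-u) ∈ A.left := by
      intro n
      induction n with
      | zero => simpa using ha
      | succ n ih =>
        rw [succ_nsmul, ← add_assoc, ← sub_eq_add_neg]
        exact step _ ih
    have h2 : -u ≤ 0 := by
      apply LGroup.nonpos_of_nsmul_le (b := b - a)
      intro n
      rw [le_sub_iff_add_le, add_comm]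
      exact mem_left_iff.1 (hn n) b hb
    exact neg_nonpos.1 h2
  · intro hu b hb a ha
    have hu : 0 ≤ u := hu
    have := mem_left_iff.1 ha _ hb
    refine le_trans ?_ hu
    rw [add_comm, ← le_neg_iff_add_nonpos_right]
    exact this

noncomputable instance : AddCommGroup (GroupCompletion D) where
  add_assoc := GroupCompletion.add_assoc
  zero_add := GroupCompletion.zero_add
  add_zero A := by rw [GroupCompletion.add_comm, GroupCompletion.zero_add]
  nsmul := nsmulRec
  zsmul := zsmulRec
  neg_add_cancel := GroupCompletion.neg_add_cancel
  add_comm := GroupCompletion.add_comm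

instance : IsOrderedAddMonoid (GroupCompletion D) where
  add_le_add_left A B h C := by
    rw [le_iff]
    intro u hu
    rw [mem_right_add] at hu ⊢
    exact fun a ha c hc => hu a (h ha) c hc

instance : IsArchimedeanLGroup (GroupCompletion D) where
  eq_zero_of_nsmul_le x y hx h := by
    have hS : IsLUB (Set.range fun n : ℕ => n • x) (sSup (Set.range fun n : ℕ => n • x)) :=
      isLUB_sSup (Set.range_nonempty _) ⟨y, by rintro _ ⟨n, rfl⟩; exact h n⟩
    set s := sSup (Set.range fun n : ℕ => n • x)
    have h1 : s ≤ s - x := by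
      apply hS.2
      rintro _ ⟨n, rfl⟩
      show n • x ≤ s - x
      rw [le_sub_iff_add_le, ← succ_nsmul]
      exact hS.1 ⟨n + 1, rfl⟩
    exact le_antisymm (by simpa using h1) hx

theorem mem_right_nsmul (A : GroupCompletion D) (n : ℕ) (u : D) :
    u ∈ (n • A).right ↔ ∀ a ∈ A.left, n • a ≤ u := by
  induction n generalizing u with
  | zero =>
    obtain ⟨a, ha⟩ := A.left_nonempty
    rw [zero_smul]
    constructor
    · intro h a _; rw [zero_smul]; exact h
    · intro h; have := h a ha; rw [zero_smul] at this; exact this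
  | succ n ih =>
    rw [succ_nsmul, mem_right_add]
    constructor
    · intro h a ha
      rw [succ_nsmul]
      refine h _ (mem_left_iff.2 fun v hv => (ih v).1 hv a ha) a ha
    · intro h x hx b hb
      rw [← le_sub_iff_add_le]
      refine mem_left_iff.1 hx _ ((ih _).2 fun a ha => ?_)
      rw [le_sub_iff_add_le]
      have hab : a ⊔ b ∈ A.left :=
        mem_left_iff.2 fun v hv => sup_le (mem_left_iff.1 ha v hv) (mem_left_iff.1 hb v hv)
      refine le_trans ?_ (h _ hab)
      rw [succ_nsmul]
      exact add_le_add (nsmul_le_nsmul_right le_sup_left n) le_sup_right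

theorem exists_nsmul_eq [IsDivisibleGroup D] {n : ℕ} (hn : 0 < n) (A : GroupCompletion D) :
    ∃ B : GroupCompletion D, n • B = A := by
  have hR : ∀ u v : D, n • v = u → u ∈ A.right →
      v ∈ (Concept.ofObjects (· ≤ ·) {d : D | n • d ∈ A.left}).intent := by
    intro u v huv hu d hd
    rw [← LGroup.nsmul_le_iff hn, huv]
    exact mem_right_iff.1 hu _ hd
  have hL : ∀ d : D, n • d ∈ A.left →
      d ∈ (Concept.ofObjects (· ≤ ·) {d : D | n • d ∈ A.left}).extent :=
    fun d hd => subset_lowerPolar_upperPolar _ _ hd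
  obtain ⟨a, ha⟩ := A.left_nonempty
  obtain ⟨b, hb⟩ := A.right_nonempty
  obtain ⟨c, hc⟩ := IsDivisibleGroup.exists_nsmul_eq n hn a
  obtain ⟨d, hd⟩ := IsDivisibleGroup.exists_nsmul_eq n hn b
  let B : GroupCompletion D := ⟨Concept.ofObjects (· ≤ ·) {d : D | n • d ∈ A.left},
    ⟨c, hL c (hc.symm ▸ ha)⟩, ⟨d, hR b d hd hb⟩⟩
  refine ⟨B, ext_right fun u => ?_⟩
  rw [mem_right_nsmul]
  constructor
  · intro h
    refine mem_right_iff.2 fun a ha => ?_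
    obtain ⟨c, rfl⟩ := IsDivisibleGroup.exists_nsmul_eq n hn a
    exact h c (hL c ha)
  · intro hu e he
    obtain ⟨v, rfl⟩ := IsDivisibleGroup.exists_nsmul_eq n hn u
    rw [LGroup.nsmul_le_iff hn]
    exact mem_left_iff.1 he v (hR _ v rfl hu)

/-! #### The real vector space structure of the completion -/

/-- The rational multiples `(m / n) x` of `x` with `m / n ≤ r`. -/
def ratMultiples (r : ℝ) (x : GroupCompletion D) : Set (GroupCompletion D) :=
  {y | ∃ (n : ℕ) (m : ℤ), 0 < n ∧ (m : ℝ) ≤ n * r ∧ n • y = m • x}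

/-- Multiplication by a real number `r`: for `x ≥ 0`, `r • x` is the supremum of the multiples
`q x` with `q ≤ r` rational, and in general `r • x = r • x⁺ - r • x⁻`. -/
noncomputable instance : SMul ℝ (GroupCompletion D) :=
  ⟨fun r x => sSup (ratMultiples r x⁺) - sSup (ratMultiples r x⁻)⟩

theorem real_smul_def (r : ℝ) (x : GroupCompletion D) :
    r • x = sSup (ratMultiples r x⁺) - sSup (ratMultiples r x⁻) := rfl

theorem le_of_mem_ratMultiples {r : ℝ} {x y w : GroupCompletion D} (hx : 0 ≤ x) {n : ℕ}
    (hn : 0 < n) (hw : n • w = (⌊n * r⌋ + 1) • x) (hy : y ∈ ratMultiples r x) : y ≤ w := by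
  obtain ⟨k, m, hk, hm, e⟩ := hy
  rw [← LGroup.nsmul_le_iff (Nat.mul_pos hn hk), mul_smul, e, mul_comm, mul_smul, hw,
    ← natCast_zsmul, ← natCast_zsmul, smul_smul, smul_smul]
  refine zsmul_le_zsmul_left hx ?_
  have h1 := (Int.lt_floor_add_one (n * r)).le
  have h2 : (n : ℝ) * m ≤ k * (⌊n * r⌋ + 1) := by
    calc (n : ℝ) * m ≤ n * (k * r) := by gcongr
      _ = k * (n * r) := by ring
      _ ≤ _ := by gcongr
  exact_mod_cast h2

variable [IsDivisibleGroup D]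

theorem exists_mem_ratMultiples (r : ℝ) (x : GroupCompletion D) {n : ℕ} (hn : 0 < n) :
    ∃ y ∈ ratMultiples r x, n • y = ⌊n * r⌋ • x := by
  obtain ⟨y, hy⟩ := exists_nsmul_eq hn (⌊n * r⌋ • x)
  exact ⟨y, ⟨n, _, hn, Int.floor_le _, hy⟩, hy⟩

theorem isLUB_ratMultiples (r : ℝ) {x : GroupCompletion D} (hx : 0 ≤ x) :
    IsLUB (ratMultiples r x) (sSup (ratMultiples r x)) := by
  obtain ⟨w, hw⟩ := exists_nsmul_eq one_pos ((⌊(1 : ℕ) * r⌋ + 1) • x)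
  obtain ⟨y, hy, -⟩ := exists_mem_ratMultiples r x one_pos
  exact isLUB_sSup ⟨y, hy⟩ ⟨w, fun z hz => le_of_mem_ratMultiples hx one_pos hw hz⟩

theorem isRealMul_sSup (r : ℝ) {x : GroupCompletion D} (hx : 0 ≤ x) :
    LGroup.IsRealMul r x (sSup (ratMultiples r x)) := by
  have hS := isLUB_ratMultiples r hx
  set s := sSup (ratMultiples r x)
  have key : ∀ n : ℕ, 0 < n → ⌊n * r⌋ • x ≤ n • s ∧ n • s ≤ (⌊n * r⌋ + 1) • x := by
    intro n hn
    constructor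
    · obtain ⟨y, hy, e⟩ := exists_mem_ratMultiples r x hn
      rw [← e]
      exact nsmul_le_nsmul_right (hS.1 hy) n
    · obtain ⟨w, hw⟩ := exists_nsmul_eq hn ((⌊n * r⌋ + 1) • x)
      rw [← hw]
      exact nsmul_le_nsmul_right (hS.2 fun y hy => le_of_mem_ratMultiples hx hn hw hy) n
  refine ⟨2 • x, fun n => ?_⟩
  have h2 : x ≤ 2 • x := le_self_nsmul hx two_ne_zero
  have h20 : 0 ≤ 2 • x := hx.trans h2
  obtain ⟨k, rfl | rfl⟩ := n.eq_nat_or_neg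
  · rcases Nat.eq_zero_or_pos k with rfl | hk
    · simpa using h20
    obtain ⟨ha, hb⟩ := key k hk
    show |(k : ℤ) • s - ⌊((k : ℤ) : ℝ) * r⌋ • x| ≤ 2 • x
    rw [abs_le', natCast_zsmul, Int.cast_natCast, neg_sub]
    constructor
    · rw [sub_le_iff_le_add']
      refine hb.trans ?_
      rw [add_smul, one_smul]
      exact add_le_add le_rfl h2
    · exact (sub_nonpos.2 ha).trans h20
  · rcases Nat.eq_zero_or_pos k with rfl | hk
    · simpa using h20
    obtain ⟨ha, hb⟩ := key k hk
    have f1 : -⌊k * r⌋ - 1 ≤ ⌊-(k * r)⌋ := by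
      rw [Int.le_floor]; push_cast
      linarith [Int.lt_floor_add_one (k * r)]
    have f2 : ⌊-(k * r)⌋ ≤ -⌊k * r⌋ := by
      have h1 := Int.floor_le (-(k * r))
      have h2 := Int.floor_le (k * r)
      have : (⌊-(k * r)⌋ : ℝ) < -⌊k * r⌋ + 1 := by linarith [Int.lt_floor_add_one (k * r)]
      have h3 : ⌊-(k * r)⌋ < -⌊k * r⌋ + 1 := by exact_mod_cast this
      omega
    have g1 := zsmul_le_zsmul_left hx f1
    have g2 := zsmul_le_zsmul_left hx f2
    rw [sub_smul, one_smul, neg_smul] at g1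
    rw [neg_smul] at g2
    rw [add_smul, one_smul] at hb
    show |(-(k : ℤ)) • s - ⌊((-(k : ℤ) : ℤ) : ℝ) * r⌋ • x| ≤ 2 • x
    rw [abs_le', neg_smul, natCast_zsmul, Int.cast_neg, Int.cast_natCast, neg_mul]
    constructor
    · rw [two_nsmul]
      have := add_le_add (neg_le_neg ha) (neg_le_neg g1)
      refine le_trans (le_of_eq ?_) (this.trans (le_of_eq_of_le ?_ (h2.trans (two_nsmul x).le)))
      · abel
      · abel
    · rw [two_nsmul]
      have := add_le_add hb g2
      refine le_trans (le_of_eq ?_) (this.trans (le_of_eq_of_le ?_ (h2.trans (two_nsmul x).le)))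
      · abel
      · abel

theorem isRealMul_smul (r : ℝ) (x : GroupCompletion D) : LGroup.IsRealMul r x (r • x) := by
  have h := (isRealMul_sSup r (posPart_nonneg x)).add_right
    (isRealMul_sSup r (negPart_nonneg x)).neg_right
  rwa [← sub_eq_add_neg, posPart_sub_negPart, ← sub_eq_add_neg] at h

noncomputable instance : Module ℝ (GroupCompletion D) where
  one_smul x := (isRealMul_smul 1 x).unique (.one x)
  mul_smul r s x := (isRealMul_smul _ x).unique ((isRealMul_smul s x).mul (isRealMul_smul r _))
  smul_zero r := (isRealMul_smul r _).unique (.zero_right r)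
  smul_add r x y :=
    (isRealMul_smul r _).unique ((isRealMul_smul r x).add_right (isRealMul_smul r y))
  add_smul r s x :=
    (isRealMul_smul _ x).unique ((isRealMul_smul r x).add_left (isRealMul_smul s x))
  zero_smul x := (isRealMul_smul 0 x).unique (.zero_left x)

theorem real_smul_nonneg {r : ℝ} {x : GroupCompletion D} (hr : 0 ≤ r) (hx : 0 ≤ x) :
    0 ≤ r • x := by
  rw [(isRealMul_smul r x).unique (isRealMul_sSup r hx)]
  exact (isLUB_ratMultiples r hx).1 ⟨1, 0, one_pos, by simpa using hr, by simp⟩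

instance : IsOrderedModule ℝ (GroupCompletion D) where
  smul_le_smul_of_nonneg_left r hr x y h := by
    rw [← sub_nonneg, ← smul_sub]
    exact real_smul_nonneg hr (sub_nonneg.2 h)
  smul_le_smul_of_nonneg_right x hx r s h := by
    rw [← sub_nonneg, ← sub_smul]
    exact real_smul_nonneg (sub_nonneg.2 h) hx

end Group

end GroupCompletion

/-! ### The vector lattice cover -/

section Cover

variable (G : Type*) [AddCommGroup G] [Lattice G] [IsOrderedAddMonoid G] [IsArchimedeanLGroup G]

/-- The embedding `g ↦ g / 1` of `G` in the Dedekind-MacNeille completion of its divisible hull. -/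
noncomputable def toCompletion : G →+ GroupCompletion (DivHull G) where
  toFun g := GroupCompletion.principal (DivHull.mk g 1)
  map_zero' := by rw [DivHull.mk_zero]; rfl
  map_add' a b := by rw [DivHull.mk_add, GroupCompletion.principal_add]

/-- The vector lattice cover `R[G]` of an archimedean lattice-ordered group `G`: the `ℓ`-subspace
generated by `G` in the Dedekind-MacNeille completion of the divisible hull of `G`, that is, the
smallest real linear subspace that contains `G` and is closed under `⊔` and `⊓`. -/
noncomputable def vectorLatticeCover : Submodule ℝ (GroupCompletion (DivHull G)) :=
  sInf {W | Set.range (toCompletion G) ⊆ W ∧ ∀ x ∈ W, ∀ y ∈ W, x ⊔ y ∈ W ∧ x ⊓ y ∈ W}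

variable {G}

theorem toCompletion_mem (g : G) : toCompletion G g ∈ vectorLatticeCover G :=
  Submodule.mem_sInf.2 fun _ hW => hW.1 ⟨g, rfl⟩

theorem vectorLatticeCover_sup_mem {x y : GroupCompletion (DivHull G)}
    (hx : x ∈ vectorLatticeCover G) (hy : y ∈ vectorLatticeCover G) :
    x ⊔ y ∈ vectorLatticeCover G :=
  Submodule.mem_sInf.2 fun W hW =>
    (hW.2 x (Submodule.mem_sInf.1 hx W hW) y (Submodule.mem_sInf.1 hy W hW)).1

theorem vectorLatticeCover_inf_mem {x y : GroupCompletion (DivHull G)}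
    (hx : x ∈ vectorLatticeCover G) (hy : y ∈ vectorLatticeCover G) :
    x ⊓ y ∈ vectorLatticeCover G :=
  Submodule.mem_sInf.2 fun W hW =>
    (hW.2 x (Submodule.mem_sInf.1 hx W hW) y (Submodule.mem_sInf.1 hy W hW)).2

/-- `R[G]` is a vector lattice with the operations of the completion. -/
noncomputable instance : Lattice (vectorLatticeCover G) :=
  Subtype.lattice (fun _ _ => vectorLatticeCover_sup_mem) (fun _ _ => vectorLatticeCover_inf_mem)

instance : IsOrderedAddMonoid (vectorLatticeCover G) where
  add_le_add_left _ _ h z := add_le_add_left (α := GroupCompletion (DivHull G)) h z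

instance : IsOrderedModule ℝ (vectorLatticeCover G) where
  smul_le_smul_of_nonneg_left _ hr _ _ h :=
    smul_le_smul_of_nonneg_left (β := GroupCompletion (DivHull G)) h hr
  smul_le_smul_of_nonneg_right _ hx _ _ h :=
    smul_le_smul_of_nonneg_right (β := GroupCompletion (DivHull G)) h hx

variable (G)

/-- The canonical embedding of `G` in `R[G]`. -/
noncomputable def toCover : G →+ vectorLatticeCover G :=
  (toCompletion G).codRestrict (vectorLatticeCover G) toCompletion_mem

variable {G}

theorem toCover_le_toCover {a b : G} : toCover G a ≤ toCover G b ↔ a ≤ b :=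
  GroupCompletion.principal_le_principal.trans DivHull.mk_le_mk

theorem toCover_sup (a b : G) : toCover G (a ⊔ b) = toCover G a ⊔ toCover G b :=
  Subtype.ext ((congrArg _ (DivHull.mk_sup a b 1)).trans (GroupCompletion.principal_sup _ _))

theorem toCover_inf (a b : G) : toCover G (a ⊓ b) = toCover G a ⊓ toCover G b :=
  Subtype.ext ((congrArg _ (DivHull.mk_inf a b 1)).trans (GroupCompletion.principal_inf _ _))

end Cover

/-! In an `f`-ring, multiplication by a positive element is positive and keeps `a` disjoint from
everything `a` was disjoint from: it is a positive orthomorphism. The multiplication is therefore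
extended one operator at a time, as a family of orthomorphisms. `IsPosOrth` is stated relative to an
embedding `ι` so that it serves `G`, its divisible hull and the completion alike; differences of
positive orthomorphisms (`orthGroup`) account for elements that are not positive.

The archimedean property makes positive orthomorphisms order continuous (`nonpos_of_forall_le_map`).
Hence the values at elements of `D` below and above a cut leave no gap (`le_of_squeeze`), which
gives both existence (`exists_extension`) and uniqueness (`eq_of_eqOn_toCompletion`) of extensions.
Left multiplications by `g` in `G` extend first; for fixed `x` in the completion, `g ↦ g x` is again
a difference of positive orthomorphisms on `G` and extends in turn (`exists_rightMul`).
Distributivity and associativity follow from uniqueness, since each is an equality of regular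
orthomorphisms that need only be checked on `G`.

Positive orthomorphisms of the completion are lattice homomorphisms, and they are real linear
because real multiples are determined by order bounds. The preimage of `R[G]` under such a map is
thus an `ℓ`-subspace, so the minimality of `R[G]` shows that it is closed under the product
(`map_mem_vectorLatticeCover`). -/

namespace LGroup

/-! ### Positive orthomorphisms and their differences -/

section Orth

variable {E V : Type*} [AddCommGroup E] [Lattice E]
  [AddCommGroup V] [Lattice V] [IsOrderedAddMonoid V]

theorem inf_eq_zero_of_le {V : Type*} [Zero V] [Lattice V] {x x' y y' : V} (hx : 0 ≤ x)
    (hxx : x ≤ x') (hy : 0 ≤ y) (hyy : y ≤ y') (h : x' ⊓ y' = 0) : x ⊓ y = 0 :=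
  le_antisymm ((inf_le_inf hxx hyy).trans h.le) (le_inf hx hy)

theorem inf_add_le {x y z : V} (hz : 0 ≤ z) : x ⊓ (y + z) ≤ x ⊓ y + z := by
  rw [← sub_le_iff_le_add]
  refine le_inf ?_ ?_
  · exact (sub_le_self _ hz).trans inf_le_left
  · rw [sub_le_iff_le_add]; exact inf_le_right

/-- Positive orthomorphisms relative to an embedding `ι`: positive additive maps `S` such that
`S a` is disjoint from `ι b` whenever `a` and `b` are disjoint. -/
structure IsPosOrth (ι S : E →+ V) : Prop where
  nonneg : ∀ a, 0 ≤ a → 0 ≤ S a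
  inf_eq_zero : ∀ a b, a ⊓ b = 0 → S a ⊓ ι b = 0

namespace IsPosOrth

variable {ι S S' : E →+ V} {T : V →+ V}

omit [IsOrderedAddMonoid V] in
theorem zero (hι : ∀ a, 0 ≤ a → 0 ≤ ι a) : IsPosOrth ι 0 where
  nonneg _ _ := le_rfl
  inf_eq_zero _ b h := inf_eq_left.2 (hι b (h ▸ inf_le_right))

theorem add (hS : IsPosOrth ι S) (hS' : IsPosOrth ι S') : IsPosOrth ι (S + S') where
  nonneg a ha := add_nonneg (hS.nonneg a ha) (hS'.nonneg a ha)
  inf_eq_zero a b h := add_inf_eq_zero (hS.inf_eq_zero a b h) (hS'.inf_eq_zero a b h)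

omit [IsOrderedAddMonoid V] in
theorem comp (hT : IsPosOrth (.id V) T) (hS : IsPosOrth ι S) : IsPosOrth ι (T.comp S) where
  nonneg a ha := hT.nonneg _ (hS.nonneg a ha)
  inf_eq_zero a b h := hT.inf_eq_zero _ _ (hS.inf_eq_zero a b h)

theorem mono [IsOrderedAddMonoid E] (hS : IsPosOrth ι S) {a b : E} (h : a ≤ b) : S a ≤ S b := by
  rw [← sub_nonneg, ← map_sub]
  exact hS.nonneg _ (sub_nonneg.2 h)

/-- Using disjointness once in each argument makes `T x⁺` and `T x⁻` disjoint, and a difference of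
disjoint elements has the first of them as its positive part. Consequently `T` preserves `⊔` and
`⊓`. -/
theorem map_posPart (hT : IsPosOrth (.id V) T) (x : V) : T x⁺ = (T x)⁺ := by
  have h1 := hT.inf_eq_zero _ _ (posPart_inf_negPart_eq_zero x)
  rw [inf_comm] at h1
  have h2 := hT.inf_eq_zero _ _ h1
  rw [inf_comm] at h2
  have h3 := posPart_sub_of_inf_eq_zero h2
  simp only [AddMonoidHom.id_apply] at h3
  rw [← map_sub, posPart_sub_negPart] at h3
  exact h3.symm

theorem map_sup (hT : IsPosOrth (.id V) T) (x y : V) : T (x ⊔ y) = T x ⊔ T y := by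
  rw [sup_eq_add_posPart_sub, sup_eq_add_posPart_sub (T x), map_add, hT.map_posPart, map_sub]

theorem map_inf (hT : IsPosOrth (.id V) T) (x y : V) : T (x ⊓ y) = T x ⊓ T y := by
  have h := congrArg T (inf_add_sup x y)
  rw [map_add, map_add, hT.map_sup, ← inf_add_sup (T x) (T y)] at h
  exact add_right_cancel h

/-- A positive additive map carries a bound for `n y - ⌊n r⌋ x` to a bound for its image. With
`IsRealMul.unique` this makes real homogeneity automatic. -/
theorem map_isRealMul (hT : IsPosOrth (.id V) T) {r : ℝ} {x y : V} (h : IsRealMul r x y) :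
    IsRealMul r (T x) (T y) := by
  obtain ⟨e, he⟩ := h
  refine ⟨T e, fun n => ?_⟩
  have h1 := abs_le'.1 (he n)
  simp only [← map_zsmul, ← map_sub, abs_le', ← map_neg] at h1 ⊢
  exact ⟨hT.mono h1.1, hT.mono h1.2⟩

end IsPosOrth

/-- The additive maps that are differences of two positive orthomorphisms. -/
def orthGroup (ι : E →+ V) (hι : ∀ a, 0 ≤ a → 0 ≤ ι a) : AddSubgroup (E →+ V) where
  carrier := {S | ∃ S₁ S₂, IsPosOrth ι S₁ ∧ IsPosOrth ι S₂ ∧ S = S₁ - S₂}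
  zero_mem' := ⟨0, 0, .zero hι, .zero hι, (sub_self _).symm⟩
  add_mem' := by
    rintro _ _ ⟨S₁, S₂, h₁, h₂, rfl⟩ ⟨S₃, S₄, h₃, h₄, rfl⟩
    exact ⟨_, _, h₁.add h₃, h₂.add h₄, sub_add_sub_comm _ _ _ _⟩
  neg_mem' := by
    rintro _ ⟨S₁, S₂, h₁, h₂, rfl⟩
    exact ⟨_, _, h₂, h₁, neg_sub _ _⟩

theorem IsPosOrth.mem_orthGroup {ι S : E →+ V} {hι : ∀ a, 0 ≤ a → 0 ≤ ι a} (h : IsPosOrth ι S) :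
    S ∈ orthGroup ι hι := ⟨S, 0, h, .zero hι, (sub_zero _).symm⟩

variable (V) in
/-- The regular orthomorphisms of `V`. -/
abbrev regOrth : AddSubgroup (V →+ V) := orthGroup (.id V) fun _ h => h

theorem comp_mem_regOrth {S T : V →+ V} (hT : T ∈ regOrth V) (hS : S ∈ regOrth V) :
    T.comp S ∈ regOrth V := by
  obtain ⟨T₁, T₂, h₁, h₂, rfl⟩ := hT
  obtain ⟨S₁, S₂, h₃, h₄, rfl⟩ := hS
  refine ⟨_, _, (h₁.comp h₃).add (h₂.comp h₄), (h₁.comp h₄).add (h₂.comp h₃), ?_⟩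
  ext x
  simp only [AddMonoidHom.comp_apply, AddMonoidHom.sub_apply, AddMonoidHom.add_apply, map_sub]
  abel

theorem map_isRealMul_of_mem_regOrth {T : V →+ V} (hT : T ∈ regOrth V) {r : ℝ} {x y : V}
    (h : IsRealMul r x y) : IsRealMul r (T x) (T y) := by
  obtain ⟨T₁, T₂, h₁, h₂, rfl⟩ := hT
  have := (h₁.map_isRealMul h).add_right (h₂.map_isRealMul h).neg_right
  rwa [← sub_eq_add_neg, ← sub_eq_add_neg] at this

end Orth

end LGroup

namespace GroupCompletion

open LGroup

/-! ### Comparing cuts through the elements of `D` -/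

section Density

variable {D : Type*} [Lattice D]

theorem mem_left_iff_principal_le {A : GroupCompletion D} {d : D} :
    d ∈ A.left ↔ principal d ≤ A := DedekindCut.principal_le_iff.symm

theorem mem_right_iff_le_principal {A : GroupCompletion D} {d : D} :
    d ∈ A.right ↔ A ≤ principal d := DedekindCut.le_principal_iff.symm

theorem le_of_forall_principal_le {A B : GroupCompletion D}
    (h : ∀ d, principal d ≤ A → principal d ≤ B) : A ≤ B :=
  fun d hd => mem_left_iff_principal_le.2 (h d (mem_left_iff_principal_le.1 hd))

theorem le_of_forall_le_principal {A B : GroupCompletion D}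
    (h : ∀ d, B ≤ principal d → A ≤ principal d) : A ≤ B :=
  le_iff.2 fun d hd => mem_right_iff_le_principal.1 hd |> h d |> mem_right_iff_le_principal.2

theorem principal_nonneg [AddCommGroup D] {d : D} (h : 0 ≤ d) : 0 ≤ principal d := principal_le_principal.2 h

end Density

/-! ### Order continuity, and extension from `D` to its completion -/

section Extension

variable {D : Type*} [Lattice D] [AddCommGroup D] [IsOrderedAddMonoid D] [IsArchimedeanLGroup D]

/-- The embedding of `D` in its completion as a group homomorphism. -/
noncomputable def principalHom (D : Type*) [Lattice D] [AddCommGroup D] [IsOrderedAddMonoid D]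
    [IsArchimedeanLGroup D] : D →+ GroupCompletion D where
  toFun := principal
  map_zero' := rfl
  map_add' := principal_add

theorem principalHom_apply (d : D) : principalHom D d = principal d := rfl

omit [IsOrderedAddMonoid D] [IsArchimedeanLGroup D] in
/-- `D` is order dense in its completion. -/
theorem eq_zero_of_forall_principal {y : GroupCompletion D} (hy : 0 ≤ y)
    (h : ∀ d : D, 0 ≤ d → principal d ≤ y → d = 0) : y = 0 := by
  refine le_antisymm (le_of_forall_principal_le fun d hd => ?_) hy
  have h1 : d ⊔ 0 = 0 := h _ le_sup_right (by rw [principal_sup]; exact sup_le hd hy)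
  exact principal_le_principal.2 (sup_eq_right.1 h1)

variable {S : D →+ GroupCompletion D}

/-- By order density it suffices to test positive `c` in `D` below `S d ⊓ w`. From `c ≤ w` it
follows that `c` is disjoint from `d`, hence from `S d`; but `c ≤ S d`, so `c = 0`. -/
theorem inf_eq_zero_of_principal (hS : IsPosOrth (principalHom D) S) {d : D} (hd : 0 ≤ d)
    {w : GroupCompletion D} (h : principal d ⊓ w = 0) : S d ⊓ w = 0 := by
  have hw : 0 ≤ w := h ▸ inf_le_right
  refine eq_zero_of_forall_principal (le_inf (hS.nonneg d hd) hw) fun c hc hcw => ?_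
  have h1 : d ⊓ c = 0 := by
    have h2 : principal d ⊓ principal c = 0 :=
      inf_eq_zero_of_le (principal_nonneg hd) le_rfl (principal_nonneg hc)
        (hcw.trans inf_le_right) h
    rw [← principal_inf] at h2
    exact le_antisymm (principal_le_principal.1 h2.le) (le_inf hd hc)
  have h3 := hS.inf_eq_zero d c h1
  rw [principalHom_apply, inf_eq_right.2 (hcw.trans inf_le_left)] at h3
  exact le_antisymm (principal_le_principal.1 h3.le) hc

/-- Positive orthomorphisms are order continuous. -/
theorem nonpos_of_forall_le_map [IsDivisibleGroup D] (hS : IsPosOrth (principalHom D) S) {A : Set D}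
    (hA : ∀ a ∈ A, 0 ≤ a) (hA' : ∀ z : GroupCompletion D, (∀ a ∈ A, z ≤ principal a) → z ≤ 0)
    {z : GroupCompletion D} (hz : ∀ a ∈ A, z ≤ S a) : z ≤ 0 := by
  rcases A.eq_empty_or_nonempty with rfl | ⟨u, hu⟩
  · exact hA' z fun a ha => ha.elim
  have hu0 := hA u hu
  -- By the archimedean property it is enough that `n • z ≤ S u` for every `n`, with `u` in `A`
  -- fixed. The excess `w` of `n • z` over `S u` is shown to vanish.
  refine nonpos_of_nsmul_le (b := S u) fun n => ?_
  rcases Nat.eq_zero_or_pos n with rfl | hn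
  · rw [zero_smul]; exact hS.nonneg u hu0
  set w := (n • z - S u)⁺ with hw
  have hw0 : 0 ≤ w := posPart_nonneg _
  -- The excess lies below `S (n • a - u)⁺`, and `(n • a - u)⁺` is disjoint from `(u - n • a)⁺`.
  have h1 : ∀ a ∈ A, w ⊓ principal (u - n • a)⁺ = 0 := by
    intro a ha
    have h2 : w ≤ S (n • a - u)⁺ := by
      refine sup_le ?_ (hS.nonneg _ (posPart_nonneg _))
      calc n • z - S u ≤ n • S a - S u := sub_le_sub_right (nsmul_le_nsmul_right (hz a ha) n) _
        _ = S (n • a - u) := by rw [map_sub, map_nsmul]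
        _ ≤ _ := hS.mono (le_posPart _)
    have h3 := hS.inf_eq_zero _ _ (posPart_inf_negPart_eq_zero (n • a - u))
    rw [← posPart_neg, neg_sub] at h3
    exact inf_eq_zero_of_le hw0 h2 (principal_nonneg (posPart_nonneg _)) le_rfl h3
  have h2 : ∀ a ∈ A, w ⊓ principal u ≤ n • principal a := by
    intro a ha
    have h3 : principal u ≤ principal (u - n • a)⁺ + n • principal a := by
      rw [← principalHom_apply a, ← map_nsmul, principalHom_apply, ← principal_add]
      exact principal_le_principal.2 (sub_le_iff_le_add.1 (le_posPart _))
    refine (inf_le_inf_left w h3).trans ((inf_add_le ?_).trans ?_)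
    · exact nsmul_nonneg (principal_nonneg (hA a ha)) n
    · rw [h1 a ha, zero_add]
  -- Dividing `w ⊓ u ≤ n • a` by `n` gives a lower bound of `A`, which is nonpositive by `hA'`.
  have h3 : principal u ⊓ w = 0 := by
    obtain ⟨v, hv⟩ := exists_nsmul_eq hn (w ⊓ principal u)
    rw [inf_comm]
    refine le_antisymm ?_ (le_inf hw0 (principal_nonneg hu0))
    rw [← hv]
    refine nsmul_nonpos (hA' v fun a ha => ?_) n
    rw [← nsmul_le_iff hn, hv]
    exact h2 a ha
  have h4 := inf_eq_zero_of_principal hS hu0 h3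
  -- Since `u` itself lies in `A`, `w` is below a multiple of `S u`, from which it is also disjoint;
  -- so `w = 0`.
  have h5 : w ≤ n • S u := by
    refine sup_le ?_ (nsmul_nonneg (hS.nonneg u hu0) n)
    exact (sub_le_self _ (hS.nonneg u hu0)).trans (nsmul_le_nsmul_right (hz u hu) n)
  have h6 := nsmul_inf_eq_zero h4 n
  rw [inf_eq_right.2 h5, hw, posPart_eq_zero, sub_nonpos] at h6
  exact h6


variable [IsDivisibleGroup D]

/-- The differences `b - a` with `a ≤ x ≤ b` have infimum `0` in the completion, and `z - z' ≤ S (b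
- a)`; order continuity concludes. -/
theorem le_of_squeeze (hS : IsPosOrth (principalHom D) S) {x z z' : GroupCompletion D}
    (hz : ∀ b, x ≤ principal b → z ≤ S b) (hz' : ∀ a, principal a ≤ x → S a ≤ z') : z ≤ z' := by
  rw [← sub_nonpos]
  refine nonpos_of_forall_le_map hS
    (A := {d | ∃ a b, principal a ≤ x ∧ x ≤ principal b ∧ d = b - a}) ?_ ?_ ?_
  · rintro _ ⟨a, b, ha, hb, rfl⟩
    exact sub_nonneg.2 (principal_le_principal.1 (ha.trans hb))
  · intro y hy
    -- For fixed `a ≤ x`, the bound `a + y ≤ c` for all `c ≥ x` gives `a + y ≤ x`; the supremum over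
    -- `a` then gives `x + y ≤ x`.
    have h1 : x ≤ x - y := by
      refine le_of_forall_principal_le fun a ha => ?_
      rw [le_sub_iff_add_le]
      refine le_of_forall_le_principal fun c hc => ?_
      have h2 := hy _ ⟨a, c, ha, hc, rfl⟩
      rwa [← principalHom_apply, map_sub, le_sub_iff_add_le'] at h2
    simpa using h1
  · rintro _ ⟨a, b, ha, hb, rfl⟩
    rw [map_sub]
    exact sub_le_sub (hz b hb) (hz' a ha)

omit [IsDivisibleGroup D] in
theorem isPosOrth_comp_principalHom {T : GroupCompletion D →+ GroupCompletion D}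
    (hT : IsPosOrth (.id _) T) : IsPosOrth (principalHom D) (T.comp (principalHom D)) where
  nonneg _ ha := hT.nonneg _ (principal_nonneg ha)
  inf_eq_zero a b h := hT.inf_eq_zero (principal a) (principal b) (by
    rw [← principal_inf, h]; rfl)

theorem eq_of_isPosOrth {T T' : GroupCompletion D →+ GroupCompletion D}
    (hT : IsPosOrth (.id _) T) (hT' : IsPosOrth (.id _) T')
    (h : ∀ d, T (principal d) = T' (principal d)) : T = T' := by
  ext1 x
  apply le_antisymm
  · exact le_of_squeeze (isPosOrth_comp_principalHom hT) (x := x) (fun b hb => hT.mono hb)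
      fun a ha => (h a).trans_le (hT'.mono ha)
  · exact le_of_squeeze (isPosOrth_comp_principalHom hT') (x := x) (fun b hb => hT'.mono hb)
      fun a ha => (h a).ge.trans (hT.mono ha)

/-- Moving the subtracted terms across reduces the claim to sums of positive orthomorphisms. -/
theorem eq_of_mem_regOrth {T T' : GroupCompletion D →+ GroupCompletion D}
    (hT : T ∈ regOrth (GroupCompletion D)) (hT' : T' ∈ regOrth (GroupCompletion D))
    (h : ∀ d, T (principal d) = T' (principal d)) : T = T' := by
  obtain ⟨T₁, T₂, h₁, h₂, rfl⟩ := hT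
  obtain ⟨T₃, T₄, h₃, h₄, rfl⟩ := hT'
  rw [sub_eq_sub_iff_add_eq_add]
  exact eq_of_isPosOrth (h₁.add h₄) (h₃.add h₂) fun d => sub_eq_sub_iff_add_eq_add.1 (h d)

/-- A positive orthomorphism on `D` extends to the completion. -/
theorem exists_extension (hS : IsPosOrth (principalHom D) S) :
    ∃ T : GroupCompletion D →+ GroupCompletion D,
      IsPosOrth (.id _) T ∧ ∀ d, T (principal d) = S d := by
  -- `T x` is the supremum of the values `S a` with `a ≤ x`.
  have hlub : ∀ x : GroupCompletion D, ∃ z, IsLUB (S '' {a | principal a ≤ x}) z := by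
    intro x
    obtain ⟨a, ha⟩ := x.left_nonempty
    obtain ⟨b, hb⟩ := x.right_nonempty
    refine ⟨_, isLUB_sSup ⟨_, a, mem_left_iff_principal_le.1 ha, rfl⟩ ⟨S b, ?_⟩⟩
    rintro _ ⟨c, hc, rfl⟩
    exact hS.mono (principal_le_principal.1
      (le_trans hc (mem_right_iff_le_principal.1 hb)))
  choose T hT using hlub
  have lower : ∀ x a, principal a ≤ x → S a ≤ T x := fun x a ha => (hT x).1 ⟨a, ha, rfl⟩
  have upper : ∀ x b, x ≤ principal b → T x ≤ S b := by
    intro x b hb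
    apply (hT x).2
    rintro _ ⟨a, ha, rfl⟩
    exact hS.mono (principal_le_principal.1 (le_trans ha hb))
  have hprin : ∀ d, T (principal d) = S d := fun d =>
    le_antisymm (upper _ _ le_rfl) (lower _ _ le_rfl)
  -- Each inequality is squeezed twice, in `x` and then in `y`, which leaves only sums of elements
  -- of `D`, where `S` is additive.
  have hadd : ∀ x y, T (x + y) = T x + T y := by
    intro x y
    apply le_antisymm
    · rw [← sub_le_iff_le_add]
      refine le_of_squeeze hS (x := x) (fun b hb => ?_) (lower x)
      rw [sub_le_comm]
      refine le_of_squeeze hS (x := y) (fun c hc => ?_) (lower y)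
      rw [sub_le_iff_le_add, ← map_add]
      refine upper _ _ ?_
      rw [principal_add, add_comm]
      exact add_le_add hc hb
    · rw [← le_sub_iff_add_le]
      refine le_of_squeeze hS (x := x) (upper x) fun a ha => ?_
      rw [le_sub_comm]
      refine le_of_squeeze hS (x := y) (upper y) fun c hc => ?_
      rw [le_sub_iff_add_le, ← map_add]
      refine lower _ _ ?_
      rw [principal_add, add_comm x]
      exact add_le_add hc ha
  let T' : GroupCompletion D →+ GroupCompletion D := AddMonoidHom.mk' T hadd
  refine ⟨T', ⟨fun x hx => ?_, fun x y hxy => ?_⟩, hprin⟩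
  · exact (map_zero S).ge.trans (lower x 0 hx)
  · have hx : 0 ≤ x := hxy ▸ inf_le_left
    have hy : 0 ≤ y := hxy ▸ inf_le_right
    have hTx : 0 ≤ T x := (map_zero S).ge.trans (lower x 0 hx)
    refine le_antisymm ?_ (le_inf hTx hy)
    -- For `a ≤ x`, `S (a ⊔ 0)` is disjoint from `T x ⊓ y`, so their sum equals their supremum and
    -- stays below `T x`.
    have h1 : T x ≤ T x - T x ⊓ y := by
      apply (hT x).2
      rintro _ ⟨a, ha, rfl⟩
      have ha0 : 0 ≤ a ⊔ 0 := le_sup_right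
      have hax : principal (a ⊔ 0) ≤ x := by
        rw [principal_sup]; exact sup_le ha hx
      have h2 : S (a ⊔ 0) ⊓ y = 0 := inf_eq_zero_of_principal hS ha0
        (inf_eq_zero_of_le (principal_nonneg ha0) hax hy le_rfl hxy)
      have h3 : S (a ⊔ 0) ⊓ (T x ⊓ y) = 0 :=
        inf_eq_zero_of_le (hS.nonneg _ ha0) le_rfl (le_inf hTx hy) inf_le_right h2
      rw [le_sub_iff_add_le]
      have h4 := inf_add_sup (S (a ⊔ 0)) (T x ⊓ y)
      rw [h3, zero_add] at h4
      calc S a + T x ⊓ y ≤ S (a ⊔ 0) + T x ⊓ y := by gcongr; exact hS.mono le_sup_left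
        _ = S (a ⊔ 0) ⊔ T x ⊓ y := h4.symm
        _ ≤ T x := sup_le (lower _ _ hax) inf_le_left
    exact (le_sub_self_iff _).1 h1

end Extension
end GroupCompletion

/-! ### Extension from `G` to the completion, and invariance of the cover -/

section FRing

open LGroup GroupCompletion

variable {G : Type*} [AddCommGroup G] [Lattice G] [IsOrderedAddMonoid G] [IsArchimedeanLGroup G]

theorem toCompletion_nonneg {a : G} (h : 0 ≤ a) : 0 ≤ toCompletion G a :=
  principal_nonneg ((DivHull.mk_zero 1).ge.trans (DivHull.mk_le_mk.2 h))

theorem toCompletion_inf (a b : G) :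
    toCompletion G (a ⊓ b) = toCompletion G a ⊓ toCompletion G b :=
  congrArg Subtype.val (toCover_inf a b)

theorem nsmul_principal_mk (a : G) (s : ℕ+) :
    (s : ℕ) • principal (DivHull.mk a s) = toCompletion G a := by
  rw [← principalHom_apply, ← map_nsmul, DivHull.nsmul_mk]
  exact congrArg principal ((congrArg _ (one_mul s).symm).trans (DivHull.mk_mul a 1 s))

theorem principal_mk_le {a : G} (ha : 0 ≤ a) (s : ℕ+) :
    principal (DivHull.mk a s) ≤ toCompletion G a := by
  rw [← nsmul_principal_mk a s]
  refine le_self_nsmul (principal_nonneg ?_) s.ne_zero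
  rw [← DivHull.mk_zero s]
  exact DivHull.mk_le_mk.2 ha

/-- `G` is cofinal because `a / s ≤ a ⊔ 0`. This allows disjointness of products with arbitrary
elements to be deduced from products with elements of `G`. -/
theorem exists_le_toCompletion (x : GroupCompletion (DivHull G)) :
    ∃ u : G, 0 ≤ u ∧ x ≤ toCompletion G u := by
  obtain ⟨d, hd⟩ := x.right_nonempty
  obtain ⟨s, a, -, rfl, -⟩ := DivHull.exists_mk d d
  refine ⟨a ⊔ 0, le_sup_right, (mem_right_iff_le_principal.1 hd).trans (le_trans ?_
    (principal_mk_le le_sup_right s))⟩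
  exact principal_le_principal.2 (DivHull.mk_le_mk.2 le_sup_left)

/-- Additive maps that agree on `G` agree on fractions, because the completion is torsion free. This
is the rigidity principle behind every algebraic identity below. -/
theorem eq_of_eqOn_toCompletion
    {T T' : GroupCompletion (DivHull G) →+ GroupCompletion (DivHull G)}
    (hT : T ∈ regOrth _) (hT' : T' ∈ regOrth _)
    (h : ∀ g, T (toCompletion G g) = T' (toCompletion G g)) : T = T' := by
  refine eq_of_mem_regOrth hT hT' fun d => ?_
  obtain ⟨s, a, -, rfl, -⟩ := DivHull.exists_mk d d
  rw [← nsmul_inj s.pos, ← map_nsmul, ← map_nsmul, nsmul_principal_mk, h]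

/-- A positive orthomorphism from `G` to the completion extends to the divisible hull of `G`. -/
theorem exists_extension_divHull {S : G →+ GroupCompletion (DivHull G)}
    (hS : IsPosOrth (toCompletion G) S) :
    ∃ S' : DivHull G →+ GroupCompletion (DivHull G),
      IsPosOrth (principalHom _) S' ∧ ∀ g, S' (DivHull.mk g 1) = S g := by
  -- The value at `a / s` is `S a` divided by `s`. Asking for the equation at every representation
  -- of `d` builds in independence of the representation.
  have key : ∀ d : DivHull G, ∃ y : GroupCompletion (DivHull G),
      ∀ (a : G) (s : ℕ+), d = DivHull.mk a s → (s : ℕ) • y = S a := by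
    intro d
    obtain ⟨s, a, -, rfl, -⟩ := DivHull.exists_mk d d
    obtain ⟨y, hy⟩ := exists_nsmul_eq s.pos (S a)
    refine ⟨y, fun b t hbt => ?_⟩
    have h1 := congrArg S (DivHull.mk_eq_mk.1 hbt)
    rw [map_nsmul, map_nsmul, ← hy, smul_smul, mul_comm, mul_smul] at h1
    exact (nsmul_inj s.pos).1 h1
  choose T hT using key
  have hadd : ∀ x y, T (x + y) = T x + T y := by
    intro x y
    obtain ⟨s, a, b, rfl, rfl⟩ := DivHull.exists_mk x y
    rw [← nsmul_inj s.pos, smul_add, hT _ a s rfl, hT _ b s rfl,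
      hT _ (a + b) s (DivHull.mk_add a b s).symm, map_add]
  have hnonneg : ∀ x, 0 ≤ x → 0 ≤ T x := by
    intro x hx
    obtain ⟨s, a, -, rfl, -⟩ := DivHull.exists_mk x x
    rw [← DivHull.mk_zero s, DivHull.mk_le_mk] at hx
    rw [← nsmul_nonneg_iff s.pos, hT _ a s rfl]
    exact hS.nonneg a hx
  refine ⟨AddMonoidHom.mk' T hadd, ⟨hnonneg, fun x y hxy => ?_⟩, fun g => ?_⟩
  · have hx : 0 ≤ x := hxy ▸ inf_le_left
    have hy : 0 ≤ y := hxy ▸ inf_le_right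
    have hx' := hnonneg x hx
    obtain ⟨s, a, b, rfl, rfl⟩ := DivHull.exists_mk x y
    rw [← DivHull.mk_zero s, DivHull.mk_le_mk] at hy
    rw [← DivHull.mk_inf, ← DivHull.mk_zero s] at hxy
    have hab : a ⊓ b = 0 :=
      le_antisymm (DivHull.mk_le_mk.1 hxy.le) (DivHull.mk_le_mk.1 hxy.ge)
    -- Both terms grow when the denominator `s` is dropped, and `S a` is disjoint from `b`.
    refine inf_eq_zero_of_le hx' ?_ (principal_nonneg ?_) (principal_mk_le hy s)
      (hS.inf_eq_zero a b hab)
    · rw [← hT _ a s rfl]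
      exact le_self_nsmul hx' s.ne_zero
    · rw [← DivHull.mk_zero s, DivHull.mk_le_mk]; exact hy
  · have := hT _ g 1 rfl
    rwa [PNat.one_coe, one_smul] at this

theorem exists_isPosOrth_extension {S : G →+ GroupCompletion (DivHull G)}
    (hS : IsPosOrth (toCompletion G) S) :
    ∃ T : GroupCompletion (DivHull G) →+ GroupCompletion (DivHull G),
      IsPosOrth (.id _) T ∧ ∀ g, T (toCompletion G g) = S g := by
  obtain ⟨S', hS', h⟩ := exists_extension_divHull hS
  obtain ⟨T, hT, h'⟩ := exists_extension hS'
  exact ⟨T, hT, fun g => (h' _).trans (h g)⟩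

theorem exists_regOrth_extension {S : G →+ GroupCompletion (DivHull G)}
    (hS : S ∈ orthGroup (toCompletion G) fun _ => toCompletion_nonneg) :
    ∃ T ∈ regOrth (GroupCompletion (DivHull G)), ∀ g, T (toCompletion G g) = S g := by
  obtain ⟨S₁, S₂, h₁, h₂, rfl⟩ := hS
  obtain ⟨T₁, hT₁, e₁⟩ := exists_isPosOrth_extension h₁
  obtain ⟨T₂, hT₂, e₂⟩ := exists_isPosOrth_extension h₂
  refine ⟨_, ⟨T₁, T₂, hT₁, hT₂, rfl⟩, fun g => ?_⟩
  rw [AddMonoidHom.sub_apply, AddMonoidHom.sub_apply, e₁, e₂]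

/-- A positive orthomorphism that maps `G` into the vector lattice cover leaves the cover
invariant. -/
theorem map_mem_vectorLatticeCover
    {T : GroupCompletion (DivHull G) →+ GroupCompletion (DivHull G)} (hT : IsPosOrth (.id _) T)
    (h : ∀ g, T (toCompletion G g) ∈ vectorLatticeCover G) {x : GroupCompletion (DivHull G)}
    (hx : x ∈ vectorLatticeCover G) : T x ∈ vectorLatticeCover G := by
  -- The preimage of the cover under `T` is an `ℓ`-subspace containing `G`, hence contains the
  -- cover.
  let W : Submodule ℝ (GroupCompletion (DivHull G)) :=
    { carrier := {y | T y ∈ vectorLatticeCover G}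
      zero_mem' := by
        show T 0 ∈ vectorLatticeCover G
        rw [map_zero]; exact zero_mem _
      add_mem' := fun {a b} ha hb => by
        show T (a + b) ∈ vectorLatticeCover G
        rw [map_add]; exact add_mem ha hb
      smul_mem' := fun r a ha => by
        show T (r • a) ∈ vectorLatticeCover G
        rw [(hT.map_isRealMul (isRealMul_smul r a)).unique (isRealMul_smul r (T a))]
        exact Submodule.smul_mem _ r ha }
  refine (Submodule.mem_sInf.1 hx W ⟨?_, fun a ha b hb => ⟨?_, ?_⟩⟩ : x ∈ W)
  · rintro _ ⟨g, rfl⟩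
    exact h g
  · show T (a ⊔ b) ∈ vectorLatticeCover G
    rw [hT.map_sup]; exact vectorLatticeCover_sup_mem ha hb
  · show T (a ⊓ b) ∈ vectorLatticeCover G
    rw [hT.map_inf]; exact vectorLatticeCover_inf_mem ha hb

end FRing

/-! ### The product on the completion -/

section Multiplication

open LGroup GroupCompletion

variable {G : Type*} [NonUnitalRing G] [Lattice G] [IsFRing G] [IsArchimedeanLGroup G]

theorem isPosOrth_mulLeft {g : G} (hg : 0 ≤ g) :
    IsPosOrth (toCompletion G) ((toCompletion G).comp (AddMonoidHom.mulLeft g)) where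
  nonneg a ha := toCompletion_nonneg (IsFRing.mul_nonneg' g a hg ha)
  inf_eq_zero a b h := by
    rw [AddMonoidHom.comp_apply, ← toCompletion_inf]
    exact (congrArg _ (IsFRing.mul_left_inf a b g h hg)).trans (map_zero _)

/-- Left multiplication by elements of `G` on the completion. -/
theorem exists_leftMul (G : Type*) [NonUnitalRing G] [Lattice G] [IsFRing G]
    [IsArchimedeanLGroup G] :
    ∃ T : G →+ GroupCompletion (DivHull G) →+ GroupCompletion (DivHull G),
      (∀ g, T g ∈ regOrth _) ∧ (∀ g, 0 ≤ g → IsPosOrth (.id _) (T g)) ∧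
      ∀ g h, T g (toCompletion G h) = toCompletion G (g * h) := by
  have h1 : ∀ g : G, ∃ T ∈ regOrth (GroupCompletion (DivHull G)),
      ∀ h, T (toCompletion G h) = toCompletion G (g * h) := by
    intro g
    refine exists_regOrth_extension (S := (toCompletion G).comp (AddMonoidHom.mulLeft g)) ?_
    refine ⟨_, _, isPosOrth_mulLeft (posPart_nonneg g), isPosOrth_mulLeft (negPart_nonneg g), ?_⟩
    ext1 a
    show toCompletion G (g * a) = toCompletion G (g⁺ * a) - toCompletion G (g⁻ * a)
    rw [← map_sub, ← sub_mul, posPart_sub_negPart]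
  choose T hT hTe using h1
  refine ⟨AddMonoidHom.mk' T fun g h => ?_, hT, fun g hg => ?_, hTe⟩
  · refine eq_of_eqOn_toCompletion (hT _) (add_mem (hT g) (hT h)) fun k => ?_
    rw [AddMonoidHom.add_apply, hTe, hTe, hTe, add_mul, map_add]
  -- The chosen `T g` is only known to be a difference; uniqueness identifies it with a positive
  -- extension.
  · obtain ⟨T', hT', e⟩ := exists_isPosOrth_extension (isPosOrth_mulLeft hg)
    convert hT'
    exact eq_of_eqOn_toCompletion (hT g) hT'.mem_orthGroup fun k => (hTe g k).trans (e k).symm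

/-- The multiplication of `G` extends to the completion; here `R x` is right multiplication by `x`. -/
theorem exists_rightMul (G : Type*) [NonUnitalRing G] [Lattice G] [IsFRing G]
    [IsArchimedeanLGroup G] :
    ∃ R : GroupCompletion (DivHull G) →+ GroupCompletion (DivHull G) →+
        GroupCompletion (DivHull G),
      (∀ x, R x ∈ regOrth _) ∧ (∀ x, 0 ≤ x → IsPosOrth (.id _) (R x)) ∧
      (∀ y, 0 ≤ y → IsPosOrth (.id _) (R.flip y)) ∧
      (∀ x y z, R z (R y x) = R (R z y) x) ∧
      ∀ g h, R (toCompletion G h) (toCompletion G g) = toCompletion G (g * h) := by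
  obtain ⟨T, hT, hTpos, hTe⟩ := exists_leftMul G
  -- If `x ≤ u` with `u` in `G`, then `g x ≤ g u`, and the right-hand `f`-ring axiom makes `g u`
  -- disjoint from `h`.
  have hpos : ∀ x, 0 ≤ x → IsPosOrth (toCompletion G) (T.flip x) := by
    refine fun x hx => ⟨fun g hg => (hTpos g hg).nonneg x hx, fun g h hgh => ?_⟩
    have hg : 0 ≤ g := hgh ▸ inf_le_left
    have hh : 0 ≤ h := hgh ▸ inf_le_right
    obtain ⟨u, hu, hxu⟩ := exists_le_toCompletion x
    refine inf_eq_zero_of_le ((hTpos g hg).nonneg x hx) ((hTpos g hg).mono hxu)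
      (toCompletion_nonneg hh) le_rfl ?_
    rw [hTe, ← toCompletion_inf, IsFRing.mul_right_inf g h u hgh hu, map_zero]
  have h1 : ∀ x, ∃ R ∈ regOrth (GroupCompletion (DivHull G)),
      ∀ g, R (toCompletion G g) = T g x := by
    intro x
    refine exists_regOrth_extension (S := T.flip x)
      ⟨_, _, hpos _ (posPart_nonneg x), hpos _ (negPart_nonneg x), ?_⟩
    rw [← map_sub, posPart_sub_negPart]
  choose R hR hRe using h1
  have hadd : ∀ x y, R (x + y) = R x + R y := by
    refine fun x y => eq_of_eqOn_toCompletion (hR _) (add_mem (hR x) (hR y)) fun k => ?_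
    rw [AddMonoidHom.add_apply, hRe, hRe, hRe, map_add]
  have hTT : ∀ g h x, T (g * h) x = T g (T h x) := by
    refine fun g h x => DFunLike.congr_fun (eq_of_eqOn_toCompletion (T' := (T g).comp (T h))
      (hT _) (comp_mem_regOrth (hT g) (hT h)) fun k => ?_) x
    rw [AddMonoidHom.comp_apply, hTe, hTe, hTe, mul_assoc]
  -- This is `(g y) z = g (y z)` for `g` in `G`. Rigidity in `y` reduces it to `hTT`, the case where
  -- two factors lie in `G`.
  have hRTc : ∀ g y z, R z (T g y) = T g (R z y) := by
    refine fun g y z => DFunLike.congr_fun (eq_of_eqOn_toCompletion (T := (R z).comp (T g))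
      (T' := (T g).comp (R z)) (comp_mem_regOrth (hR z) (hT g))
      (comp_mem_regOrth (hT g) (hR z)) fun k => ?_) y
    rw [AddMonoidHom.comp_apply, AddMonoidHom.comp_apply, hTe, hRe, hRe, hTT]
  have hRpos : ∀ x, 0 ≤ x → IsPosOrth (.id _) (R x) := by
    intro x hx
    obtain ⟨R', hR', e⟩ := exists_isPosOrth_extension (hpos x hx)
    convert hR'
    exact eq_of_eqOn_toCompletion (hR x) hR'.mem_orthGroup fun k => (hRe x k).trans (e k).symm
  refine ⟨AddMonoidHom.mk' R hadd, hR, hRpos, fun y hy => ⟨fun x hx => (hRpos x hx).nonneg y hy,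
    fun a b hab => ?_⟩, fun x y z => ?_, fun g h => (hRe _ g).trans (hTe g h)⟩
  · have ha : 0 ≤ a := hab ▸ inf_le_left
    have hb : 0 ≤ b := hab ▸ inf_le_right
    obtain ⟨u, hu, hyu⟩ := exists_le_toCompletion y
    -- The product `y a` is below `u a = T u a`, and `T u` is a positive orthomorphism.
    refine inf_eq_zero_of_le ((hRpos a ha).nonneg y hy) ((hRpos a ha).mono hyu) hb le_rfl ?_
    rw [hRe]
    exact (hTpos u hu).inf_eq_zero a b hab
  -- Associativity: both sides are regular orthomorphisms in `x`, and for `x` in `G` they agree by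
  -- `hRTc`.
  · refine DFunLike.congr_fun (eq_of_eqOn_toCompletion (T := (R z).comp (R y))
      (T' := R (R z y)) (comp_mem_regOrth (hR z) (hR y)) (hR _) fun k => ?_) x
    rw [AddMonoidHom.comp_apply, hRe, hRe, hRTc]

end Multiplication

/-! ### Restriction of the product to the cover -/

theorem mainTheorem4 (G : Type*) [NonUnitalRing G] [Lattice G] [IsFRing G]
    [IsArchimedeanLGroup G] :
    ∃ m : vectorLatticeCover G →ₗ[ℝ] vectorLatticeCover G →ₗ[ℝ] vectorLatticeCover G,
      IsFAlgebraMul m ∧ ∀ a b : G, m (toCover G a) (toCover G b) = toCover G (a * b) := by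
  obtain ⟨R, hR, hRpos, hRflip, hassoc, hRe⟩ := exists_rightMul G
  have hflip : ∀ y, R.flip y ∈ LGroup.regOrth _ := fun y =>
    ⟨_, _, hRflip _ (posPart_nonneg y), hRflip _ (negPart_nonneg y), by
      rw [← map_sub, posPart_sub_negPart]⟩
  have hsmul : ∀ {T : GroupCompletion (DivHull G) →+ GroupCompletion (DivHull G)},
      T ∈ LGroup.regOrth _ → ∀ (r : ℝ) x, T (r • x) = r • T x := fun hT r x =>
    (LGroup.map_isRealMul_of_mem_regOrth hT (GroupCompletion.isRealMul_smul r x)).unique (GroupCompletion.isRealMul_smul r _)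
  -- Invariance is used twice. Left multiplication by `g` maps `G` into `G`, so it preserves the
  -- cover; hence right multiplication by a positive `x` of the cover maps `G` into the cover, and
  -- so preserves it too.
  have hmem₁ : ∀ g : G, 0 ≤ g → ∀ x ∈ vectorLatticeCover G,
      R x (toCompletion G g) ∈ vectorLatticeCover G := fun g hg x hx =>
    map_mem_vectorLatticeCover (hRflip _ (toCompletion_nonneg hg)) (fun h => by
      rw [AddMonoidHom.flip_apply, hRe]; exact toCompletion_mem _) hx
  have hmem₂ : ∀ g : G, ∀ x ∈ vectorLatticeCover G,
      R x (toCompletion G g) ∈ vectorLatticeCover G := by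
    intro g x hx
    rw [← posPart_sub_negPart g, map_sub, map_sub]
    exact sub_mem (hmem₁ _ (posPart_nonneg g) x hx) (hmem₁ _ (negPart_nonneg g) x hx)
  have hmem₃ : ∀ x ∈ vectorLatticeCover G, 0 ≤ x → ∀ y ∈ vectorLatticeCover G,
      R x y ∈ vectorLatticeCover G := fun x hx hx0 y hy =>
    map_mem_vectorLatticeCover (hRpos x hx0) (fun g => hmem₂ g x hx) hy
  have hmem : ∀ x ∈ vectorLatticeCover G, ∀ y ∈ vectorLatticeCover G,
      R x y ∈ vectorLatticeCover G := by
    intro x hx y hy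
    rw [← posPart_sub_negPart x, map_sub, AddMonoidHom.sub_apply]
    exact sub_mem
      (hmem₃ _ (vectorLatticeCover_sup_mem hx (zero_mem _)) (posPart_nonneg x) y hy)
      (hmem₃ _ (vectorLatticeCover_sup_mem (neg_mem hx) (zero_mem _)) (negPart_nonneg x) y hy)
  -- The arguments are swapped because `R y` multiplies by `y` on the right.
  refine ⟨LinearMap.mk₂ ℝ (fun x y => ⟨R y x, hmem _ y.2 _ x.2⟩)
    (fun x x' y => Subtype.ext (map_add (R y) _ _))
    (fun r x y => Subtype.ext (hsmul (hR _) r _))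
    (fun x y y' => Subtype.ext (map_add (R.flip x) _ _))
    (fun r x y => Subtype.ext (hsmul (hflip _) r _)), ⟨?_, ?_, ?_, ?_⟩, ?_⟩
  · exact fun a b c => Subtype.ext (hassoc a b c)
  · exact fun a b ha hb => (hRpos b hb).nonneg a ha
  · exact fun a b c h hc => Subtype.ext ((hRflip c hc).inf_eq_zero a b (congrArg Subtype.val h))
  · exact fun a b c h hc => Subtype.ext ((hRpos c hc).inf_eq_zero a b (congrArg Subtype.val h))
  · exact fun a b => Subtype.ext (hRe a b)
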